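/- Consider the following homogeneous-user fetching problem. There are $N\ge 1$ users. In each slot the content at the sensor is updated once with probability $p\in(0,1]$, and each user requests the content with probability $q\in(0,1]$, all independently. The age cost $C_a:\{0,1,2,\dots\}\to[0,\infty)$ is convex and (strictly) increasing, and $C_f>0$ is the cost of a fetch and broadcast. The state is $(\tau,m)$, where $\tau\in\{1,2,\dots\}$ is the time since the last fetch and $m\in\{0,\dots,N\}$ is the current number of requests. Let $\bar C_{av}(\tau)=\mathbb E[C_a(V)]$ with $V\sim\mathrm{Binomial}(\tau,p)$. Action $1$ (fetch and broadcast) costs $C_f$ and leads to $(1,M)$; action $0$ costs $m\,\bar C_{av}(\tau)$ and leads to $(\tau+1,M)$, where $M\sim\mathrm{Binomial}(N,q)$ is independent of the past. The objective is to minimize, over all randomized history-dependent policies, the long-run average expected cost $\limsup_{T\to\infty}\frac1T\,\mathbb E\big[\sum_{t=1}^{T}\text{cost}(t)\big]$. The optimal average cost is a finite number $\bar\theta$ that does not depend on the initial state, and there is a relative cost function $\bar h$, i.e. a real-valued solution of the Bellman equation $$\bar h(\tau,m)+\bar\theta=\min\{\,C_f+\bar h_{av}(1),\; m\,\bar C_{av}(\tau)+\bar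 h_{av}(\tau+1)\},\qquad \bar h_{av}(\tau)=\sum_{k=0}^{N}\binom Nk q^k(1-q)^{N-k}\,\bar h(\tau,k)$$ (which, if $q=1$, is also required to be bounded below). For every such $\bar h$, let $\bar\pi(\tau,m)=1$ if the first term in the minimum is less than or equal to the second, and $\bar\pi(\tau,m)=0$ otherwise. Then the stationary policy $\bar\pi$ attains the optimal average cost from every initial state, and: 1. $\bar\pi(\tau,0)=0$ for all $\tau\ge1$. 2. For every $m\in\{1,\dots,N\}$, the threshold $\bar\tau(m)=\min\{\tau\ge1:\bar h_{av}(\tau+1)\ge C_f+\bar h_{av}(1)-m\,\bar C_{av}(\tau)\}$ is finite, and $\bar\pi(\tau,m)=1$ if and only if $\tau\ge\bar\tau(m)$. 3. $\bar\tau(m-1)\ge\bar\tau(m)$ for every $m\in\{1,\dots,N\}$, where $\bar\tau(0)$ is defined by the same formula, with $\min\emptyset=\infty$. -/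

import Mathlib

open Filter Topology

noncomputable section

namespace FetchMDP

/-- Data of the homogeneous-user fetching problem: `N` users, per-slot content update
probability `p`, per-slot request probability `q` of each user, fetching (and broadcasting)
cost `Cf`, and age cost `Ca v` of serving a request with version age `v`. -/
structure Model where
  N : ℕ
  p : ℝ
  q : ℝ
  Cf : ℝ
  Ca : ℕ → ℝ

/-- The binomial weight `B(n, x, k)`. -/
def binom (n : ℕ) (x : ℝ) (k : ℕ) : ℝ :=
  (n.choose k : ℝ) * x ^ k * (1 - x) ^ (n - k)

namespace Model

variable (M : Model)

/-- States `(τ, m)`: `τ ≥ 1` is the time since the last fetch, `m ∈ {0, …, N}` is the number of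
requests. -/
abbrev State : Type := ℕ+ × Fin (M.N + 1)

/-- Expected age cost of one request, `E[Ca(V)]` with `V ∼ Binomial(τ, p)`. -/
def Cav (τ : ℕ) : ℝ := ∑ v ∈ Finset.range (τ + 1), binom τ M.p v * M.Ca v

/-- Expected single stage cost. The action `true` is fetch and broadcast, `false` is neither. -/
def stageCost (s : M.State) (a : Bool) : ℝ :=
  if a then M.Cf else ((s.2 : ℕ) : ℝ) * M.Cav s.1

/-- The time since the last fetch in the next slot. -/
def nextAge (τ : ℕ+) (a : Bool) : ℕ+ := if a then 1 else τ + 1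

/-- Expectation over the number of requests `k ∼ Binomial(N, q)` of a slot. -/
def avg (g : Fin (M.N + 1) → ℝ) : ℝ := ∑ k : Fin (M.N + 1), binom M.N M.q k * g k

/-- Randomized history-dependent policies: the probability of fetching, given the list of past
state-action pairs (most recent first) and the current state. -/
abbrev Policy : Type := List (M.State × Bool) → M.State → unitInterval

/-- Expected total cost of the next `T` slots under `π`, given the past `H` and the current
state `s`. In each slot the action is drawn from `π`, the stage cost is paid, and the number of
requests of the next slot is an independent `Binomial(N, q)` variable. -/
def totalCost (π : M.Policy) : ℕ → List (M.State × Bool) → M.State → ℝ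
  | 0, _, _ => 0
  | T + 1, H, s =>
      (π H s : ℝ) * (M.stageCost s true
        + M.avg fun k => totalCost π T ((s, true) :: H) (nextAge s.1 true, k))
      + (1 - (π H s : ℝ)) * (M.stageCost s false
        + M.avg fun k => totalCost π T ((s, false) :: H) (nextAge s.1 false, k))

/-- Long run time averaged expected cost of `π` from the initial state `s` (possibly `⊤`). -/
def averageCost (π : M.Policy) (s : M.State) : EReal :=
  limsup (fun T : ℕ => ((M.totalCost π T [] s / (T : ℝ) : ℝ) : EReal)) atTop

/-- Optimal average cost from the initial state `s`. -/
def optimalCost (s : M.State) : EReal := ⨅ π : M.Policy, M.averageCost π s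

/-- The policy attached to a stationary deterministic decision rule. -/
def stationary (u : M.State → Bool) : M.Policy := fun _ s => if u s then 1 else 0

/-- A decision rule is average-cost optimal if it attains the optimal average cost from every
initial state. -/
def IsOptimal (u : M.State → Bool) : Prop :=
  ∀ s : M.State, M.averageCost (M.stationary u) s = M.optimalCost s

/-- `h_av(τ) = ∑ₖ B(N, q, k) h(τ, k)`. -/
def hav (h : M.State → ℝ) (τ : ℕ+) : ℝ := M.avg fun k => h (τ, k)

/-- `h` is a relative cost function for the average cost `θ`: it solves the Bellman equation.
If `q = 1` almost all states are transient and the Bellman equation has spurious solutions that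
tend to `-∞`; only in that case is `h` also required to be bounded below. -/
structure IsRelativeCost (θ : ℝ) (h : M.State → ℝ) : Prop where
  bellman : ∀ s : M.State, h s + θ =
    min (M.stageCost s true + M.hav h 1) (M.stageCost s false + M.hav h (s.1 + 1))
  bddBelow : M.q = 1 → BddBelow (Set.range h)

open Classical in
/-- The policy selected by the Bellman equation: fetch iff the term of fetching is at most the
term of not fetching. -/
def bellmanPolicy (h : M.State → ℝ) (s : M.State) : Bool :=
  decide (M.stageCost s true + M.hav h 1 ≤ M.stageCost s false + M.hav h (s.1 + 1))

/-- `min {τ ≥ 1 : h_av(τ+1) ≥ Cf + h_av(1) - m C_av(τ)}`, with value `⊤` if there is no such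
`τ`. -/
def threshold (h : M.State → ℝ) (m : ℕ) : ℕ∞ :=
  ⨅ (τ : ℕ+) (_ : M.Cf + M.hav h 1 - (m : ℝ) * M.Cav τ ≤ M.hav h (τ + 1)), ((τ : ℕ) : ℕ∞)

end Model

end FetchMDP

end

/-! The Bellman equation depends on `h` only through `h_av`, hence through the margin
`D τ = Cf + h_av 1 - h_av τ`, and it reads
`D τ = θ + E[(D (τ + 1) - k C_av τ)⁺]` with `D 1 = Cf`, where `k ∼ Binomial(N, q)`.
Not fetching in state `(τ, m)` is strictly better than fetching exactly when
`m C_av τ < D (τ + 1)`.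

*Existence.* By convexity and strict monotonicity of the age cost, `C_av` is nondecreasing and
unbounded. Beyond an age `K` at which `C_av` exceeds `Cf / (1 - q₀)`, with `q₀ = (1 - q)^N` the
probability of no request, the recursion is solved by the constant `θ / (1 - q₀)`, for every
`θ ∈ [0, Cf]`. Running the recursion backwards from `K` gives a bounded solution which is
continuous in `θ`, and the intermediate value theorem produces a `θ` with `D 1 = Cf`
(`exists_margin`).

*Boundedness of all solutions.* If `q < 1`, then `x ↦ E[(x - k C_av τ)⁺]` is strictly increasing on
`x ≥ 0`, so `D (τ + 1)` is determined by `D τ`: there is only one solution for the given `θ`, the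
bounded one just constructed. If `q = 1`, boundedness comes from `IsRelativeCost.bddBelow`. A
bounded `h` allows the usual verification argument (`le_totalCost`, `totalCost_stationary_le`),
which shows that `θ` is the optimal cost and that the Bellman policy attains it.

*Structure.* A bounded margin is eventually constant, and the recursion carries `D (τ + 1) ≤ D τ`
backwards from there because `C_av` is nondecreasing (`IsMargin.antitone`). So `D (τ + 1)`
decreases while `m C_av τ` increases, which makes the fetching region a half-line; it is nonempty
for `m ≥ 1` because `D` is bounded, empty for `m = 0` because `D ≥ θ > 0`, and it grows with `m`. -/

open Filter Topology

namespace FetchMDP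

/-! ### Binomial averages -/

lemma binom_nonneg {x : ℝ} (h0 : 0 ≤ x) (h1 : x ≤ 1) (n k : ℕ) : 0 ≤ binom n x k := by
  have : 0 ≤ 1 - x := by linarith
  unfold binom
  positivity

lemma sum_binom (n : ℕ) (x : ℝ) : ∑ k ∈ Finset.range (n + 1), binom n x k = 1 := by
  have h := add_pow x (1 - x) n
  rw [add_sub_cancel, one_pow] at h
  rw [h]
  refine Finset.sum_congr rfl fun k _ => ?_
  unfold binom
  ring

/-- Conditioning on the first of `n + 1` Bernoulli trials. -/
lemma sum_binom_succ (n : ℕ) (x : ℝ) (f : ℕ → ℝ) :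
    ∑ v ∈ Finset.range (n + 2), binom (n + 1) x v * f v
      = (1 - x) * ∑ v ∈ Finset.range (n + 1), binom n x v * f v
        + x * ∑ v ∈ Finset.range (n + 1), binom n x v * f (v + 1) := by
  have h := Finset.sum_choose_succ_mul (fun i j => x ^ i * (1 - x) ^ j * f i) n
  have e : ∀ v, binom (n + 1) x v * f v
      = ((n + 1).choose v : ℝ) * (x ^ v * (1 - x) ^ (n + 1 - v) * f v) := fun v => by
    unfold binom; ring
  simp only [e]
  rw [h, Finset.mul_sum, Finset.mul_sum]
  congr 1
  · refine Finset.sum_congr rfl fun v hv => ?_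
    have hv' : v ≤ n := Nat.lt_succ_iff.mp (Finset.mem_range.mp hv)
    rw [Nat.succ_sub hv', pow_succ]
    unfold binom
    ring
  · refine Finset.sum_congr rfl fun v _ => ?_
    unfold binom
    ring

namespace Model

variable {M : Model}

lemma avg_mono (hq0 : 0 < M.q) (hq1 : M.q ≤ 1) {f g : Fin (M.N + 1) → ℝ} (h : ∀ k, f k ≤ g k) :
    M.avg f ≤ M.avg g :=
  Finset.sum_le_sum fun k _ => mul_le_mul_of_nonneg_left (h k) (binom_nonneg hq0.le hq1 _ _)

lemma avg_const (c : ℝ) : (M.avg fun _ => c) = c := by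
  unfold avg
  rw [← Finset.sum_mul, Fin.sum_univ_eq_sum_range (fun k => binom M.N M.q k), sum_binom, one_mul]

lemma avg_add_const (f : Fin (M.N + 1) → ℝ) (c : ℝ) :
    (M.avg fun k => f k + c) = M.avg f + c := by
  have h : (M.avg fun k => f k + c) = M.avg f + M.avg fun _ => c := by
    simp only [avg, mul_add, Finset.sum_add_distrib]
  rw [h, avg_const]

lemma avg_neg (f : Fin (M.N + 1) → ℝ) : (M.avg fun k => -f k) = -M.avg f := by
  simp only [avg, mul_neg, Finset.sum_neg_distrib]

/-! ### The expected age cost -/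

lemma cav_succ (τ : ℕ) :
    M.Cav (τ + 1) - M.Cav τ
      = M.p * ∑ v ∈ Finset.range (τ + 1), binom τ M.p v * (M.Ca (v + 1) - M.Ca v) := by
  have h := sum_binom_succ τ M.p M.Ca
  unfold Cav
  simp only [mul_sub, Finset.sum_sub_distrib]
  linarith

lemma cav_add_le (hp0 : 0 < M.p) (hp1 : M.p ≤ 1)
    (hconv : ∀ v : ℕ, M.Ca (v + 1) - M.Ca v ≤ M.Ca (v + 2) - M.Ca (v + 1)) (τ : ℕ) :
    M.Cav τ + M.p * (M.Ca 1 - M.Ca 0) ≤ M.Cav (τ + 1) := by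
  have hinc : Monotone fun v => M.Ca (v + 1) - M.Ca v := monotone_nat_of_le_succ hconv
  have h := cav_succ (M := M) τ
  have h2 : (M.Ca 1 - M.Ca 0)
      ≤ ∑ v ∈ Finset.range (τ + 1), binom τ M.p v * (M.Ca (v + 1) - M.Ca v) := by
    calc M.Ca 1 - M.Ca 0
        = ∑ v ∈ Finset.range (τ + 1), binom τ M.p v * (M.Ca 1 - M.Ca 0) := by
          rw [← Finset.sum_mul, sum_binom, one_mul]
      _ ≤ _ := Finset.sum_le_sum fun v _ =>
          mul_le_mul_of_nonneg_left (hinc (Nat.zero_le v)) (binom_nonneg hp0.le hp1 _ _)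
  nlinarith [mul_le_mul_of_nonneg_left h2 hp0.le]

lemma cav_zero : M.Cav 0 = M.Ca 0 := by simp [Cav, binom]

lemma cav_monotone (hp0 : 0 < M.p) (hp1 : M.p ≤ 1) (hinc : StrictMono M.Ca)
    (hconv : ∀ v : ℕ, M.Ca (v + 1) - M.Ca v ≤ M.Ca (v + 2) - M.Ca (v + 1)) :
    Monotone M.Cav := by
  refine monotone_nat_of_le_succ fun τ => ?_
  have h := cav_add_le hp0 hp1 hconv τ
  have : 0 ≤ M.p * (M.Ca 1 - M.Ca 0) :=
    mul_nonneg hp0.le (sub_nonneg.mpr (hinc zero_lt_one).le)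
  linarith

lemma exists_le_cav (hp0 : 0 < M.p) (hp1 : M.p ≤ 1) (hCa0 : 0 ≤ M.Ca 0) (hinc : StrictMono M.Ca)
    (hconv : ∀ v : ℕ, M.Ca (v + 1) - M.Ca v ≤ M.Ca (v + 2) - M.Ca (v + 1)) (B : ℝ) :
    ∃ K : ℕ, ∀ τ, K ≤ τ → B ≤ M.Cav τ := by
  have hpos : 0 < M.p * (M.Ca 1 - M.Ca 0) := mul_pos hp0 (sub_pos.mpr (hinc zero_lt_one))
  have hlin : ∀ τ : ℕ, (τ : ℝ) * (M.p * (M.Ca 1 - M.Ca 0)) ≤ M.Cav τ := by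
    intro τ
    induction τ with
    | zero => simpa [cav_zero] using hCa0
    | succ n ih =>
      have := cav_add_le hp0 hp1 hconv n
      push_cast
      linarith
  obtain ⟨K, hK⟩ := exists_nat_ge (B / (M.p * (M.Ca 1 - M.Ca 0)))
  refine ⟨K, fun τ hτ => ?_⟩
  rw [div_le_iff₀ hpos] at hK
  exact (hK.trans (hlin K)).trans (cav_monotone hp0 hp1 hinc hconv hτ)

/-! ### The margin recursion -/

/-- `E[(x - k c)⁺]` for `k ∼ Binomial(N, q)`: the expected gain from the option of not fetching,
when one request costs `c` and deferring the fetch is worth `x`. -/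
noncomputable def optionValue (M : Model) (c x : ℝ) : ℝ := M.avg fun k => max 0 (x - (k : ℕ) * c)

/-- The probability that a slot has no request. -/
noncomputable def idleProb (M : Model) : ℝ := (1 - M.q) ^ M.N

lemma idleProb_nonneg (hq1 : M.q ≤ 1) : 0 ≤ M.idleProb := pow_nonneg (by linarith) _

lemma idleProb_lt_one (hN : 1 ≤ M.N) (hq0 : 0 < M.q) (hq1 : M.q ≤ 1) : M.idleProb < 1 :=
  pow_lt_one₀ (by linarith) (by linarith) (by omega)

lemma optionValue_nonneg (hq0 : 0 < M.q) (hq1 : M.q ≤ 1) (c x : ℝ) : 0 ≤ M.optionValue c x := by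
  rw [← avg_const (M := M) 0]
  exact avg_mono hq0 hq1 fun k => le_max_left _ _

lemma optionValue_mono (hq0 : 0 < M.q) (hq1 : M.q ≤ 1) {c c' x x' : ℝ} (hc : c' ≤ c)
    (hx : x ≤ x') : M.optionValue c x ≤ M.optionValue c' x' := by
  refine avg_mono hq0 hq1 fun k => max_le_max le_rfl ?_
  have : ((k : ℕ) : ℝ) * c' ≤ (k : ℕ) * c := mul_le_mul_of_nonneg_left hc (Nat.cast_nonneg _)
  linarith

lemma continuous_optionValue (c : ℝ) : Continuous (M.optionValue c) := by
  unfold optionValue avg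
  fun_prop

lemma optionValue_eq_add (c : ℝ) {x : ℝ} (hx : 0 ≤ x) :
    M.optionValue c x = M.idleProb * x
      + ∑ k : Fin M.N, binom M.N M.q (k + 1) * max 0 (x - ((k : ℕ) + 1) * c) := by
  unfold optionValue avg idleProb
  rw [Fin.sum_univ_succ]
  simp [binom, hx]

/-- If every request costs at least `x`, only idle slots contribute. -/
lemma optionValue_of_le {c x : ℝ} (hx : 0 ≤ x) (hc : x ≤ c) :
    M.optionValue c x = M.idleProb * x := by
  rw [optionValue_eq_add c hx, Finset.sum_eq_zero, add_zero]
  intro k _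
  have : 0 ≤ ((k : ℕ) : ℝ) * c := mul_nonneg (Nat.cast_nonneg _) (hx.trans hc)
  rw [max_eq_left (by linarith), mul_zero]

lemma optionValue_strictMonoOn (hq0 : 0 < M.q) (hq1 : M.q < 1) (c : ℝ) :
    StrictMonoOn (M.optionValue c) (Set.Ici 0) := by
  intro x hx y hy hxy
  rw [optionValue_eq_add c hx, optionValue_eq_add c hy]
  have h0 : 0 < M.idleProb := pow_pos (by linarith) _
  refine add_lt_add_of_lt_of_le (mul_lt_mul_of_pos_left hxy h0) (Finset.sum_le_sum fun k _ => ?_)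
  exact mul_le_mul_of_nonneg_left (max_le_max le_rfl (by linarith)) (binom_nonneg hq0.le hq1.le _ _)

/-- `D` is a margin for the average cost `θ`: it solves the Bellman equation written in terms of
`D τ = Cf + h_av 1 - h_av τ`. -/
structure IsMargin (M : Model) (θ : ℝ) (D : ℕ+ → ℝ) : Prop where
  one : D 1 = M.Cf
  recursion : ∀ τ : ℕ+, D τ = θ + M.optionValue (M.Cav τ) (D (τ + 1))

lemma IsMargin.le (hq0 : 0 < M.q) (hq1 : M.q ≤ 1) {θ : ℝ} {D : ℕ+ → ℝ} (hD : M.IsMargin θ D)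
    (τ : ℕ+) : θ ≤ D τ := by
  rw [hD.recursion τ]
  linarith [optionValue_nonneg hq0 hq1 (M.Cav τ) (D (τ + 1))]

/-- If `q < 1`, the recursion can be solved forwards, so the margin is determined by `θ`. -/
lemma IsMargin.unique (hq0 : 0 < M.q) (hq1 : M.q < 1) {θ : ℝ} (hθ : 0 ≤ θ) {D D' : ℕ+ → ℝ}
    (hD : M.IsMargin θ D) (hD' : M.IsMargin θ D') : D = D' := by
  funext τ
  induction τ using PNat.recOn with
  | one => rw [hD.one, hD'.one]
  | succ τ ih =>
    rw [hD.recursion τ, hD'.recursion τ] at ih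
    exact (optionValue_strictMonoOn hq0 hq1 _).injOn (hθ.trans (hD.le hq0 hq1.le _))
      (hθ.trans (hD'.le hq0 hq1.le _)) (add_left_cancel ih)

/-- `n` backward steps of the margin recursion, ending at age `τ`, from the terminal value
`θ / (1 - q₀)`. -/
noncomputable def backward (M : Model) (θ : ℝ) : ℕ → ℕ → ℝ
  | 0, _ => θ / (1 - M.idleProb)
  | n + 1, τ => θ + M.optionValue (M.Cav τ) (backward M θ n (τ + 1))

lemma continuous_backward (n τ : ℕ) : Continuous fun θ => M.backward θ n τ := by
  induction n generalizing τ with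
  | zero => exact continuous_id.div_const _
  | succ n ih => exact continuous_id.add ((continuous_optionValue _).comp (ih _))

lemma backward_zero (hCav : ∀ τ, 0 ≤ M.Cav τ) (n τ : ℕ) : M.backward 0 n τ = 0 := by
  induction n generalizing τ with
  | zero => simp [backward]
  | succ n ih => simp [backward, ih, optionValue_of_le le_rfl (hCav τ)]

lemma le_backward (hN : 1 ≤ M.N) (hq0 : 0 < M.q) (hq1 : M.q ≤ 1) {θ : ℝ} (hθ : 0 ≤ θ)
    (n τ : ℕ) : θ ≤ M.backward θ n τ := by
  cases n with
  | zero =>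
    have h0 := idleProb_nonneg hq1
    have h1 := idleProb_lt_one hN hq0 hq1
    rw [backward, le_div_iff₀ (by linarith)]
    nlinarith
  | succ n =>
    rw [backward]
    linarith [optionValue_nonneg hq0 hq1 (M.Cav τ) (M.backward θ n (τ + 1))]

/-- There are a positive average cost and a bounded margin for it. -/
lemma exists_margin (hN : 1 ≤ M.N) (hp0 : 0 < M.p) (hp1 : M.p ≤ 1) (hq0 : 0 < M.q) (hq1 : M.q ≤ 1)
    (hCf : 0 < M.Cf) (hCa0 : 0 ≤ M.Ca 0) (hinc : StrictMono M.Ca)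
    (hconv : ∀ v : ℕ, M.Ca (v + 1) - M.Ca v ≤ M.Ca (v + 2) - M.Ca (v + 1)) :
    ∃ (θ : ℝ) (D : ℕ+ → ℝ), 0 < θ ∧ M.IsMargin θ D ∧ ∃ B, ∀ τ, D τ ≤ B := by
  have h1 : 0 < 1 - M.idleProb := sub_pos.mpr (idleProb_lt_one hN hq0 hq1)
  have hCav : ∀ τ, 0 ≤ M.Cav τ := fun τ =>
    (cav_zero (M := M) ▸ hCa0).trans (cav_monotone hp0 hp1 hinc hconv (Nat.zero_le τ))
  obtain ⟨K, hK⟩ := exists_le_cav hp0 hp1 hCa0 hinc hconv (M.Cf / (1 - M.idleProb))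
  obtain ⟨θ, ⟨hθ0, hθ1⟩, hθ⟩ := intermediate_value_Icc hCf.le
    (continuous_backward (M := M) (K - 1) 1).continuousOn
    ⟨(backward_zero hCav _ _).trans_le hCf.le, le_backward hN hq0 hq1 hCf.le _ _⟩
  simp only at hθ
  have hθpos : 0 < θ := hθ0.lt_of_ne' fun h => by
    rw [h, backward_zero hCav] at hθ
    exact hCf.ne hθ
  refine ⟨θ, fun τ => M.backward θ (K - τ) τ, hθpos, ⟨by simpa using hθ, fun τ => ?_⟩, ?_⟩
  · rcases lt_or_ge (τ : ℕ) K with h | h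
    · have e : K - (τ : ℕ) = (K - ((τ + 1 : ℕ+) : ℕ)) + 1 := by rw [PNat.add_coe, PNat.one_coe]; omega
      simp only [e, backward]
      rw [PNat.add_coe, PNat.one_coe]
    · have e : K - (τ : ℕ) = 0 := by omega
      have e' : K - ((τ + 1 : ℕ+) : ℕ) = 0 := by rw [PNat.add_coe, PNat.one_coe]; omega
      simp only [e, e', backward]
      rw [optionValue_of_le (div_nonneg hθ0 h1.le)
        ((div_le_div_of_nonneg_right hθ1 h1.le).trans (hK τ h))]
      field_simp
      ring
  · -- Beyond `K` the margin is constant, so only finitely many values occur.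
    obtain ⟨B, hB⟩ := (Set.finite_range fun i : Fin (K + 1) =>
      M.backward θ (K - i) i).bddAbove
    refine ⟨max B (θ / (1 - M.idleProb)), fun τ => ?_⟩
    rcases lt_or_ge (τ : ℕ) K with h | h
    · exact le_max_of_le_left (hB ⟨⟨τ, by omega⟩, rfl⟩)
    · have e : K - (τ : ℕ) = 0 := by omega
      simp only [e, backward]
      exact le_max_right _ _

/-- Where `C_av` exceeds a bound of the margin, the recursion becomes `D τ = θ + q₀ D (τ + 1)`,
whose only bounded solution is constant. -/
lemma IsMargin.eq_of_le (hN : 1 ≤ M.N) (hq0 : 0 < M.q) (hq1 : M.q ≤ 1) {θ B : ℝ} (hθ : 0 ≤ θ)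
    {D : ℕ+ → ℝ} (hD : M.IsMargin θ D) (hB : ∀ τ, D τ ≤ B) {K : ℕ}
    (hK : ∀ τ, K ≤ τ → B ≤ M.Cav τ) (τ : ℕ+) (hτ : K ≤ τ) : D τ = θ / (1 - M.idleProb) := by
  have h0 := idleProb_nonneg hq1
  have h1 := idleProb_lt_one hN hq0 hq1
  have h1' : 1 - M.idleProb ≠ 0 := by linarith
  set r := M.idleProb with hr
  set d := θ / (1 - r) with hd
  have hfix : d = θ + r * d := by rw [hd]; field_simp; ring
  have hstep : ∀ σ : ℕ+, K ≤ σ → D σ - d = r * (D (σ + 1) - d) := by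
    intro σ hσ
    have h := hD.recursion σ
    rw [optionValue_of_le (hθ.trans (hD.le hq0 hq1 _)) ((hB _).trans (hK σ hσ))] at h
    linarith
  have hbd : ∀ n : ℕ, ∀ σ : ℕ+, K ≤ σ → |D σ - d| ≤ r ^ n * (B + |d|) := by
    intro n
    induction n with
    | zero =>
      intro σ _
      have h2 : 0 ≤ D σ := hθ.trans (hD.le hq0 hq1 σ)
      rw [pow_zero, one_mul]
      refine (abs_sub _ _).trans ?_
      rw [abs_of_nonneg h2]
      linarith [hB σ]
    | succ n ih =>
      intro σ hσ
      rw [hstep σ hσ, abs_mul, abs_of_nonneg h0, pow_succ', mul_assoc]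
      exact mul_le_mul_of_nonneg_left (ih _ (by rw [PNat.add_coe]; omega)) h0
  have hlim : Tendsto (fun n : ℕ => r ^ n * (B + |d|)) atTop (𝓝 0) := by
    simpa using (tendsto_pow_atTop_nhds_zero_of_lt_one h0 h1).mul_const (B + |d|)
  have := ge_of_tendsto' hlim fun n => hbd n τ hτ
  exact sub_eq_zero.mp (abs_nonpos_iff.mp this)

lemma IsMargin.antitone (hN : 1 ≤ M.N) (hq0 : 0 < M.q) (hq1 : M.q ≤ 1) (hmono : Monotone M.Cav)
    {θ B : ℝ} (hθ : 0 ≤ θ) {D : ℕ+ → ℝ} (hD : M.IsMargin θ D) (hB : ∀ τ, D τ ≤ B) {K : ℕ}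
    (hK : ∀ τ, K ≤ τ → B ≤ M.Cav τ) : Antitone D := by
  have key : ∀ n : ℕ, ∀ τ : ℕ+, K ≤ τ + n → D (τ + 1) ≤ D τ := by
    intro n
    induction n with
    | zero =>
      intro τ hτ
      have hτ' : K ≤ ((τ + 1 : ℕ+) : ℕ) := by rw [PNat.add_coe]; omega
      rw [hD.eq_of_le hN hq0 hq1 hθ hB hK τ hτ, hD.eq_of_le hN hq0 hq1 hθ hB hK _ hτ']
    | succ n ih =>
      intro τ hτ
      have h := ih (τ + 1) (by rw [PNat.add_coe, PNat.one_coe]; omega)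
      have hc : M.Cav τ ≤ M.Cav (τ + 1 : ℕ+) := hmono (by rw [PNat.add_coe]; omega)
      linarith [hD.recursion τ, hD.recursion (τ + 1), optionValue_mono hq0 hq1 hc h]
  intro a b hab
  induction b using PNat.recOn with
  | one => rw [le_antisymm hab one_le]
  | succ b ih =>
    rcases hab.lt_or_eq with h | h
    · exact (key K b (by omega)).trans (ih (PNat.lt_add_one_iff.mp h))
    · rw [h]

/-! ### Relative cost functions and margins -/

lemma stageCost_true (s : M.State) : M.stageCost s true = M.Cf := rfl

lemma stageCost_false (s : M.State) : M.stageCost s false = ((s.2 : ℕ) : ℝ) * M.Cav s.1 := rfl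

/-- The margin `D τ = Cf + h_av 1 - h_av τ`. -/
noncomputable def margin (M : Model) (h : M.State → ℝ) (τ : ℕ+) : ℝ := M.Cf + M.hav h 1 - M.hav h τ

lemma IsRelativeCost.eq_sub_max {θ : ℝ} {h : M.State → ℝ} (hh : M.IsRelativeCost θ h)
    (s : M.State) :
    h s = M.Cf + M.hav h 1 - θ - max 0 (M.margin h (s.1 + 1) - (s.2 : ℕ) * M.Cav s.1) := by
  have h1 := hh.bellman s
  rw [stageCost_true, stageCost_false] at h1
  unfold margin
  rcases le_total (M.Cf + M.hav h 1) ((s.2 : ℕ) * M.Cav s.1 + M.hav h (s.1 + 1)) with h2 | h2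
  · rw [min_eq_left h2] at h1
    rw [max_eq_left (by linarith)]
    linarith
  · rw [min_eq_right h2] at h1
    rw [max_eq_right (by linarith)]
    linarith

lemma IsRelativeCost.isMargin {θ : ℝ} {h : M.State → ℝ} (hh : M.IsRelativeCost θ h) :
    M.IsMargin θ (M.margin h) := by
  refine ⟨by simp [margin], fun τ => ?_⟩
  have e : M.hav h τ = -M.optionValue (M.Cav τ) (M.margin h (τ + 1))
      + (M.Cf + M.hav h 1 - θ) := by
    have e1 : M.hav h τ = M.avg fun k : Fin (M.N + 1) =>
        -max 0 (M.margin h (τ + 1) - (k : ℕ) * M.Cav τ) + (M.Cf + M.hav h 1 - θ) := by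
      unfold hav
      congr 1
      funext k
      rw [hh.eq_sub_max (τ, k)]
      unfold hav
      ring
    rw [e1, avg_add_const, avg_neg, optionValue]
  nth_rewrite 1 [margin]
  linarith

/-- A bounded margin comes from a bounded relative cost function, normalized so that
`Cf + h_av 1 = 0`. -/
lemma IsMargin.exists_isRelativeCost (hq0 : 0 < M.q) (hq1 : M.q ≤ 1) (hCav : ∀ τ, 0 ≤ M.Cav τ)
    {θ B : ℝ} {D : ℕ+ → ℝ} (hD : M.IsMargin θ D) (hθ : 0 ≤ θ) (hB : ∀ τ, D τ ≤ B) :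
    ∃ h, M.IsRelativeCost θ h := by
  set h : M.State → ℝ := fun s => -max 0 (D (s.1 + 1) - (s.2 : ℕ) * M.Cav s.1) + -θ with h_def
  have hav_eq : ∀ τ, M.hav h τ = -D τ := by
    intro τ
    rw [hD.recursion τ]
    simp only [hav, h_def]
    rw [avg_add_const, avg_neg, optionValue]
    ring
  refine ⟨h, ⟨fun s => ?_, fun _ => ⟨-B - θ, ?_⟩⟩⟩
  · rw [hav_eq, hav_eq, stageCost_true, stageCost_false, hD.one]
    simp only [h_def]
    rcases le_total (D (s.1 + 1)) ((s.2 : ℕ) * M.Cav s.1) with h2 | h2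
    · rw [max_eq_left (by linarith), min_eq_left (by linarith)]
      ring
    · rw [max_eq_right (by linarith), min_eq_right (by linarith)]
      ring
  · rintro _ ⟨s, rfl⟩
    have h1 : 0 ≤ ((s.2 : ℕ) : ℝ) * M.Cav s.1 := mul_nonneg (Nat.cast_nonneg _) (hCav _)
    have h2 : 0 ≤ D (s.1 + 1) := hθ.trans (hD.le hq0 hq1 _)
    have h3 : max 0 (D (s.1 + 1) - (s.2 : ℕ) * M.Cav s.1) ≤ B :=
      max_le (h2.trans (hB _)) (by linarith [hB (s.1 + 1)])
    simp only [h_def]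
    linarith

/-- For `q < 1` the bound is inherited from any bounded margin, by uniqueness. -/
lemma IsRelativeCost.margin_le (hq0 : 0 < M.q) (hq1 : M.q ≤ 1) {θ B : ℝ} (hθ : 0 ≤ θ)
    {D : ℕ+ → ℝ} (hD : M.IsMargin θ D) (hB : ∀ τ, D τ ≤ B) {h : M.State → ℝ}
    (hh : M.IsRelativeCost θ h) : ∃ B', ∀ τ, M.margin h τ ≤ B' := by
  rcases hq1.lt_or_eq with hq | hq
  · exact ⟨B, fun τ => hh.isMargin.unique hq0 hq hθ hD ▸ hB τ⟩
  · obtain ⟨L, hL⟩ := hh.bddBelow hq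
    refine ⟨M.Cf + M.hav h 1 - L, fun τ => ?_⟩
    have : L ≤ M.hav h τ := by
      rw [← avg_const (M := M) L]
      exact avg_mono hq0 hq1 fun k => hL ⟨(τ, k), rfl⟩
    unfold margin
    linarith

lemma IsRelativeCost.exists_abs_le (hq0 : 0 < M.q) (hq1 : M.q ≤ 1) (hCav : ∀ τ, 0 ≤ M.Cav τ)
    {θ B : ℝ} (hθ : 0 ≤ θ) {h : M.State → ℝ} (hh : M.IsRelativeCost θ h)
    (hB : ∀ τ, M.margin h τ ≤ B) : ∃ b, ∀ s, |h s| ≤ b := by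
  refine ⟨|M.Cf + M.hav h 1 - θ| + B, fun s => ?_⟩
  have h1 : 0 ≤ ((s.2 : ℕ) : ℝ) * M.Cav s.1 := mul_nonneg (Nat.cast_nonneg _) (hCav _)
  have h2 : 0 ≤ M.margin h (s.1 + 1) := hθ.trans (hh.isMargin.le hq0 hq1 _)
  rw [hh.eq_sub_max s]
  refine (abs_sub _ _).trans (add_le_add le_rfl ?_)
  rw [abs_of_nonneg (le_max_left _ _)]
  exact max_le (h2.trans (hB _)) (by linarith [hB (s.1 + 1)])

lemma bellmanPolicy_iff (h : M.State → ℝ) (τ : ℕ+) (m : Fin (M.N + 1)) :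
    M.bellmanPolicy h (τ, m) = true ↔ M.margin h (τ + 1) ≤ (m : ℕ) * M.Cav τ := by
  unfold bellmanPolicy margin
  rw [decide_eq_true_iff, stageCost_true, stageCost_false, sub_le_iff_le_add]

/-! ### Verification -/

lemma hav_nextAge_true (h : M.State → ℝ) (τ : ℕ+) :
    (M.avg fun k => h (nextAge τ true, k)) = M.hav h 1 := rfl

lemma hav_nextAge_false (h : M.State → ℝ) (τ : ℕ+) :
    (M.avg fun k => h (nextAge τ false, k)) = M.hav h (τ + 1) := rfl

lemma le_totalCost (hq0 : 0 < M.q) (hq1 : M.q ≤ 1) {θ b : ℝ} {h : M.State → ℝ}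
    (hh : M.IsRelativeCost θ h) (hb : ∀ s, |h s| ≤ b) (π : M.Policy) (T : ℕ)
    (H : List (M.State × Bool)) (s : M.State) :
    h s + (T * θ - b) ≤ M.totalCost π T H s := by
  induction T generalizing H s with
  | zero =>
    simp only [totalCost, Nat.cast_zero, zero_mul]
    linarith [(abs_le.mp (hb s)).2]
  | succ T ih =>
    have hstep : ∀ a : Bool, (M.avg fun k => h (nextAge s.1 a, k)) + (T * θ - b)
        ≤ M.avg fun k => M.totalCost π T ((s, a) :: H) (nextAge s.1 a, k) := by
      intro a
      rw [← avg_add_const]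
      exact avg_mono hq0 hq1 fun k => ih _ _
    have ht := hstep true
    have hf := hstep false
    rw [hav_nextAge_true h] at ht
    rw [hav_nextAge_false h] at hf
    have hbell := hh.bellman s
    have h1 := min_le_left (M.stageCost s true + M.hav h 1)
      (M.stageCost s false + M.hav h (s.1 + 1))
    have h2 := min_le_right (M.stageCost s true + M.hav h 1)
      (M.stageCost s false + M.hav h (s.1 + 1))
    have hπ0 := (π H s).2.1
    have hπ1 := (π H s).2.2
    rw [totalCost]
    push_cast
    generalize (π H s : ℝ) = x at *
    have k1 := mul_le_mul_of_nonneg_left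
      (show h s + ((T + 1) * θ - b) ≤ M.stageCost s true
        + M.avg fun k => M.totalCost π T ((s, true) :: H) (nextAge s.1 true, k) by linarith) hπ0
    have k2 := mul_le_mul_of_nonneg_left
      (show h s + ((T + 1) * θ - b) ≤ M.stageCost s false
        + M.avg fun k => M.totalCost π T ((s, false) :: H) (nextAge s.1 false, k) by linarith)
      (sub_nonneg.mpr hπ1)
    linarith

lemma totalCost_stationary_le (hq0 : 0 < M.q) (hq1 : M.q ≤ 1) {θ b : ℝ} {h : M.State → ℝ}
    (hh : M.IsRelativeCost θ h) (hb : ∀ s, |h s| ≤ b) (T : ℕ)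
    (H : List (M.State × Bool)) (s : M.State) :
    M.totalCost (M.stationary (M.bellmanPolicy h)) T H s ≤ h s + (T * θ + b) := by
  induction T generalizing H s with
  | zero =>
    simp only [totalCost, Nat.cast_zero, zero_mul]
    linarith [(abs_le.mp (hb s)).1]
  | succ T ih =>
    have hstep : ∀ a : Bool, (M.avg fun k => M.totalCost (M.stationary (M.bellmanPolicy h)) T
        ((s, a) :: H) (nextAge s.1 a, k))
        ≤ (M.avg fun k => h (nextAge s.1 a, k)) + (T * θ + b) := by
      intro a
      rw [← avg_add_const]
      exact avg_mono hq0 hq1 fun k => ih _ _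
    have hbell := hh.bellman s
    rw [totalCost]
    push_cast
    by_cases hs : M.stageCost s true + M.hav h 1 ≤ M.stageCost s false + M.hav h (s.1 + 1)
    · have hu : M.bellmanPolicy h s = true := decide_eq_true hs
      have ht := hstep true
      rw [hav_nextAge_true h] at ht
      rw [min_eq_left hs] at hbell
      simp only [stationary, hu, if_true, Set.Icc.coe_one, one_mul, sub_self, zero_mul, add_zero]
      linarith
    · have hu : M.bellmanPolicy h s = false := decide_eq_false hs
      have hf := hstep false
      rw [hav_nextAge_false h] at hf
      rw [min_eq_right (not_le.mp hs).le] at hbell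
      simp only [stationary, hu, Bool.false_eq_true, if_false, Set.Icc.coe_zero, zero_mul, sub_zero,
        one_mul, zero_add]
      linarith

lemma tendsto_linear_div (θ c : ℝ) :
    Tendsto (fun T : ℕ => (((c + T * θ) / T : ℝ) : EReal)) atTop (𝓝 (θ : EReal)) := by
  refine (continuous_coe_real_ereal.tendsto θ).comp ?_
  have h1 : Tendsto (fun T : ℕ => c / (T : ℝ) + θ) atTop (𝓝 (0 + θ)) :=
    (tendsto_const_div_atTop_nhds_zero_nat c).add_const θ
  rw [zero_add] at h1
  refine h1.congr' ?_
  filter_upwards [eventually_gt_atTop 0] with T hT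
  have : (T : ℝ) ≠ 0 := Nat.cast_ne_zero.mpr hT.ne'
  field_simp

lemma le_averageCost (hq0 : 0 < M.q) (hq1 : M.q ≤ 1) {θ b : ℝ} {h : M.State → ℝ}
    (hh : M.IsRelativeCost θ h) (hb : ∀ s, |h s| ≤ b) (π : M.Policy) (s : M.State) :
    (θ : EReal) ≤ M.averageCost π s := by
  rw [← (tendsto_linear_div θ (h s - b)).limsup_eq]
  refine limsup_le_limsup (Eventually.of_forall fun T => EReal.coe_le_coe_iff.mpr ?_)
  refine div_le_div_of_nonneg_right ?_ (Nat.cast_nonneg T)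
  linarith [le_totalCost hq0 hq1 hh hb π T [] s]

lemma averageCost_bellmanPolicy (hq0 : 0 < M.q) (hq1 : M.q ≤ 1) {θ b : ℝ} {h : M.State → ℝ}
    (hh : M.IsRelativeCost θ h) (hb : ∀ s, |h s| ≤ b) (s : M.State) :
    M.averageCost (M.stationary (M.bellmanPolicy h)) s = θ := by
  refine le_antisymm ?_ (le_averageCost hq0 hq1 hh hb _ s)
  rw [← (tendsto_linear_div θ (h s + b)).limsup_eq]
  refine limsup_le_limsup (Eventually.of_forall fun T => EReal.coe_le_coe_iff.mpr ?_)
  refine div_le_div_of_nonneg_right ?_ (Nat.cast_nonneg T)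
  linarith [totalCost_stationary_le hq0 hq1 hh hb T [] s]

lemma optimalCost_eq (hq0 : 0 < M.q) (hq1 : M.q ≤ 1) {θ b : ℝ} {h : M.State → ℝ}
    (hh : M.IsRelativeCost θ h) (hb : ∀ s, |h s| ≤ b) (s : M.State) :
    M.optimalCost s = θ :=
  le_antisymm ((iInf_le _ _).trans_eq (averageCost_bellmanPolicy hq0 hq1 hh hb s))
    (le_iInf fun π => le_averageCost hq0 hq1 hh hb π s)

/-! ### Thresholds -/

lemma threshold_eq (h : M.State → ℝ) (m : ℕ) :
    M.threshold h m
      = ⨅ (τ : ℕ+) (_ : M.margin h (τ + 1) ≤ m * M.Cav τ), ((τ : ℕ) : ℕ∞) := by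
  unfold threshold margin
  refine iInf_congr fun τ => iInf_congr_Prop ?_ fun _ => rfl
  constructor <;> intro _ <;> linarith

lemma threshold_le_iff (hmono : Monotone M.Cav) {h : M.State → ℝ}
    (hanti : Antitone (M.margin h)) (m : ℕ) (τ : ℕ+) :
    M.threshold h m ≤ ((τ : ℕ) : ℕ∞) ↔ M.margin h (τ + 1) ≤ m * M.Cav τ := by
  rw [threshold_eq]
  refine ⟨fun hle => ?_, fun hc => iInf₂_le τ hc⟩
  by_contra hn
  have : (((τ : ℕ) + 1 : ℕ) : ℕ∞)
      ≤ ⨅ (σ : ℕ+) (_ : M.margin h (σ + 1) ≤ m * M.Cav σ), ((σ : ℕ) : ℕ∞) := by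
    refine le_iInf₂ fun σ hσ => Nat.cast_le.mpr ?_
    by_contra hlt
    have hστ : σ ≤ τ := PNat.coe_le_coe _ _ |>.mp (by omega)
    refine hn ((hanti (add_le_add_left hστ 1)).trans (hσ.trans ?_))
    exact mul_le_mul_of_nonneg_left (hmono hστ) (Nat.cast_nonneg _)
  have h2 := Nat.cast_le.mp (this.trans hle)
  omega

lemma threshold_antitone (hCav : ∀ τ, 0 ≤ M.Cav τ) (h : M.State → ℝ) :
    Antitone (M.threshold h) := by
  intro m n hmn
  rw [threshold_eq, threshold_eq]
  refine iInf_mono fun τ => iInf_mono' fun hτ => ⟨hτ.trans ?_, le_rfl⟩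
  exact mul_le_mul_of_nonneg_right (Nat.cast_le.mpr hmn) (hCav _)

end Model

end FetchMDP

theorem theorem1 (M : FetchMDP.Model) (hN : 1 ≤ M.N)
    (hp0 : 0 < M.p) (hp1 : M.p ≤ 1) (hq0 : 0 < M.q) (hq1 : M.q ≤ 1) (hCf : 0 < M.Cf)
    (hCa0 : 0 ≤ M.Ca 0) (hCa_incr : StrictMono M.Ca)
    (hCa_convex : ∀ v : ℕ, M.Ca (v + 1) - M.Ca v ≤ M.Ca (v + 2) - M.Ca (v + 1)) :
    ∃ θ : ℝ,
      (∀ s : M.State, M.optimalCost s = (θ : EReal)) ∧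
      (∃ h : M.State → ℝ, M.IsRelativeCost θ h) ∧
      ∀ h : M.State → ℝ, M.IsRelativeCost θ h →
        M.IsOptimal (M.bellmanPolicy h) ∧
        (∀ τ : ℕ+, M.bellmanPolicy h (τ, 0) = false) ∧
        (∀ m : Fin (M.N + 1), 1 ≤ (m : ℕ) →
          M.threshold h m ≠ ⊤ ∧
          ∀ τ : ℕ+, (M.bellmanPolicy h (τ, m) = true ↔ M.threshold h m ≤ ((τ : ℕ) : ℕ∞))) ∧
        (∀ m : ℕ, 1 ≤ m → m ≤ M.N → M.threshold h m ≤ M.threshold h (m - 1)) := by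
  have hmono := FetchMDP.Model.cav_monotone hp0 hp1 hCa_incr hCa_convex
  have hCav : ∀ τ, 0 ≤ M.Cav τ := fun τ =>
    (FetchMDP.Model.cav_zero (M := M) ▸ hCa0).trans (hmono (Nat.zero_le τ))
  obtain ⟨θ, D, hθ, hD, B, hB⟩ :=
    FetchMDP.Model.exists_margin hN hp0 hp1 hq0 hq1 hCf hCa0 hCa_incr hCa_convex
  obtain ⟨h₀, hh₀⟩ := hD.exists_isRelativeCost hq0 hq1 hCav hθ.le hB
  obtain ⟨B₀, hB₀⟩ := hh₀.margin_le hq0 hq1 hθ.le hD hB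
  obtain ⟨b₀, hb₀⟩ := hh₀.exists_abs_le hq0 hq1 hCav hθ.le hB₀
  have hopt := FetchMDP.Model.optimalCost_eq hq0 hq1 hh₀ hb₀
  refine ⟨θ, hopt, ⟨h₀, hh₀⟩, fun h hh => ?_⟩
  obtain ⟨B', hB'⟩ := hh.margin_le hq0 hq1 hθ.le hD hB
  obtain ⟨b, hb⟩ := hh.exists_abs_le hq0 hq1 hCav hθ.le hB'
  obtain ⟨K, hK⟩ := FetchMDP.Model.exists_le_cav hp0 hp1 hCa0 hCa_incr hCa_convex B'
  have hanti := hh.isMargin.antitone hN hq0 hq1 hmono hθ.le hB' hK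
  refine ⟨fun s => ?_, fun τ => ?_, fun m hm => ⟨?_, fun τ => ?_⟩, fun m _ _ => ?_⟩
  · rw [FetchMDP.Model.averageCost_bellmanPolicy hq0 hq1 hh hb, hopt]
  · rw [Bool.eq_false_iff, Ne, FetchMDP.Model.bellmanPolicy_iff, not_le]
    simpa using hθ.trans_le (hh.isMargin.le hq0 hq1 (τ + 1))
  · -- The threshold is at most `K + 1`, as `C_av` exceeds the bound `B'` of the margin there.
    refine ne_top_of_le_ne_top (ENat.natCast_ne_top (K.succPNat : ℕ))
      ((FetchMDP.Model.threshold_le_iff hmono hanti m K.succPNat).mpr ?_)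
    have h1 : B' ≤ M.Cav K.succPNat := hK _ (Nat.le_succ K)
    have h2 : (1 : ℝ) ≤ (m : ℕ) := Nat.one_le_cast.mpr hm
    exact ((hB' _).trans h1).trans (le_mul_of_one_le_left (hCav _) h2)
  · rw [FetchMDP.Model.bellmanPolicy_iff, FetchMDP.Model.threshold_le_iff hmono hanti]
  · exact FetchMDP.Model.threshold_antitone hCav h (Nat.sub_le m 1)
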